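/- Theorem 1.2 (Metric properties of $\mathcal N^{\#}_{\mathcal X}$). Let $\mathcal X$ be a complete separable metric space with a fixed origin $x_0\in\mathcal X$, and let $\mathcal N^{\#}_{\mathcal X}$ be the set of all Borel measures $\xi$ on $\mathcal X$ with values in $\{0,1,2,\dots\}\cup\{\infty\}$ that are boundedly finite, i.e. $\xi(A)<\infty$ for every bounded Borel set $A$. For $r\ge 0$ let $B_r$ be the open ball of radius $r$ centred at $x_0$ and let $\xi^{(r)}(A)=\xi(A\cap B_r)$. For totally finite Borel measures $\mu,\nu$ let $$d(\mu,\nu)=\inf\{\varepsilon\ge 0:\ \mu(A)\le\nu(A^{\varepsilon})+\varepsilon\ \text{and}\ \nu(A)\le\mu(A^{\varepsilon})+\varepsilon\ \text{for all closed } A\subset\mathcal X\}$$ be the Prohorov distance, where $A^{\varepsilon}$ is the union of the open balls of radius $\varepsilon$ centred at points of $A$. For $\mu,\nu\in\mathcal N^{\#}_{\mathcal X}$ put $$d^{\#}(\mu,\nu)=\int_0^\infty e^{-r}\,\frac{d(\mu^{(r)},\nu^{(r)})}{1+d(\mu^{(r)},\nu^{(r)})}\,dr .$$ Then the integrand is integrable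 on $(0,\infty)$ for all $\mu,\nu\in\mathcal N^{\#}_{\mathcal X}$, so that $d^{\#}$ is well defined, and: (i) $d^{\#}$ is a metric on $\mathcal N^{\#}_{\mathcal X}$, and with this metric $\mathcal N^{\#}_{\mathcal X}$ is a complete separable metric space. (ii) The Borel $\sigma$-algebra of $(\mathcal N^{\#}_{\mathcal X},d^{\#})$ is the smallest $\sigma$-algebra on $\mathcal N^{\#}_{\mathcal X}$ that makes all mappings $\Phi_A:\xi\mapsto\xi(A)$, $A$ a Borel subset of $\mathcal X$, measurable. -/

import Mathlib

open MeasureTheory Set TopologicalSpace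
open scoped ENNReal

noncomputable section

/-- The space of boundedly finite integer-valued Borel measures on `X`: measures which are finite
on bounded Borel sets and whose values on Borel sets lie in `ℕ ∪ {∞}`. -/
structure BoundedlyFiniteIntMeasure (X : Type*) [MetricSpace X] [MeasurableSpace X] where
  /-- The underlying measure. -/
  toMeasure : Measure X
  /-- Bounded Borel sets have finite measure. -/
  lt_top_of_isBounded : ∀ A : Set X, MeasurableSet A → Bornology.IsBounded A → toMeasure A < ∞
  /-- Borel sets have measure in `ℕ ∪ {∞}`. -/
  integer_valued : ∀ A : Set X, MeasurableSet A → toMeasure A = ∞ ∨ ∃ n : ℕ, toMeasure A = n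

/-- The Prohorov distance between (totally finite) measures: the infimum of all real `ε ≥ 0` with
`μ A ≤ ν (A^ε) + ε` and `ν A ≤ μ (A^ε) + ε` for all closed `A`, where `A^ε` is the union of the
open balls of radius `ε` centred in `A`. -/
def prohorovDist {X : Type*} [MetricSpace X] [MeasurableSpace X] (μ ν : Measure X) : ℝ :=
  sInf {ε : ℝ | 0 ≤ ε ∧ ∀ A : Set X, IsClosed A →
    μ A ≤ ν (Metric.thickening ε A) + ENNReal.ofReal ε ∧
    ν A ≤ μ (Metric.thickening ε A) + ENNReal.ofReal ε}

/-- On totally finite measures this is Mathlib's Lévy–Prokhorov distance. -/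
theorem prohorovDist_eq_levyProkhorovDist {X : Type*} [MetricSpace X] [MeasurableSpace X]
    [OpensMeasurableSpace X] (μ ν : Measure X) [IsFiniteMeasure μ] [IsFiniteMeasure ν] :
    prohorovDist μ ν = levyProkhorovDist μ ν := by
  have key : ∀ ε : ℝ, 0 ≤ ε →
      ((∀ A : Set X, IsClosed A →
        μ A ≤ ν (Metric.thickening ε A) + ENNReal.ofReal ε ∧
        ν A ≤ μ (Metric.thickening ε A) + ENNReal.ofReal ε) ↔
      (∀ B : Set X, MeasurableSet B →
        μ B ≤ ν (Metric.thickening ε B) + ENNReal.ofReal ε ∧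
        ν B ≤ μ (Metric.thickening ε B) + ENNReal.ofReal ε)) := by
    intro ε _
    constructor
    · intro h B _
      have h1 := h (closure B) isClosed_closure
      rw [Metric.thickening_closure] at h1
      exact ⟨(measure_mono subset_closure).trans h1.1, (measure_mono subset_closure).trans h1.2⟩
    · intro h A hA
      exact h A hA.measurableSet
  refine le_antisymm ?_ ?_
  · refine le_of_forall_pos_le_add fun δ hδ => ?_
    refine csInf_le ⟨0, fun x hx => hx.1⟩ ⟨by unfold levyProkhorovDist; positivity, ?_⟩
    have h0 : 0 ≤ levyProkhorovDist μ ν + δ := by unfold levyProkhorovDist; positivity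
    rw [key _ h0]
    have hlt : levyProkhorovEDist μ ν < ENNReal.ofReal (levyProkhorovDist μ ν + δ) := by
      rw [ENNReal.lt_ofReal_iff_toReal_lt (levyProkhorovEDist_ne_top μ ν)]
      exact lt_add_of_pos_right _ hδ
    intro B hB
    have h1 := left_measure_le_of_levyProkhorovEDist_lt hlt hB
    have h2 := right_measure_le_of_levyProkhorovEDist_lt hlt hB
    rw [ENNReal.toReal_ofReal h0] at h1 h2
    exact ⟨h1, h2⟩
  · refine le_csInf ?_ ?_
    · refine ⟨max (μ univ).toReal (ν univ).toReal, le_max_of_le_left ENNReal.toReal_nonneg,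
        fun A _ => ⟨?_, ?_⟩⟩
      · refine le_add_left ((measure_mono (subset_univ A)).trans ?_)
        exact (ENNReal.ofReal_toReal (measure_ne_top μ univ)).symm.le.trans
          (ENNReal.ofReal_le_ofReal (le_max_left _ _))
      · refine le_add_left ((measure_mono (subset_univ A)).trans ?_)
        exact (ENNReal.ofReal_toReal (measure_ne_top ν univ)).symm.le.trans
          (ENNReal.ofReal_le_ofReal (le_max_right _ _))
    · rintro ε ⟨hε, h⟩
      rw [key ε hε] at h
      refine ENNReal.toReal_le_of_le_ofReal hε (sInf_le ?_)
      intro B hB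
      rw [ENNReal.toReal_ofReal hε]
      exact h B hB

namespace BoundedlyFiniteIntMeasure

variable {X : Type*} [MetricSpace X] [MeasurableSpace X]

/-- The restriction `ξ^(r)` of `ξ` to the open ball of radius `r` about the origin `x₀`. -/
def restrictBall (x₀ : X) (ξ : BoundedlyFiniteIntMeasure X) (r : ℝ) : Measure X :=
  ξ.toMeasure.restrict (Metric.ball x₀ r)

/-- The integrand of the weak-hash distance,
`e^(-r) * d(μ^(r), ν^(r)) / (1 + d(μ^(r), ν^(r)))`. -/
def weakHashIntegrand (x₀ : X) (μ ν : BoundedlyFiniteIntMeasure X) (r : ℝ) : ℝ :=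
  Real.exp (-r) * (prohorovDist (restrictBall x₀ μ r) (restrictBall x₀ ν r) /
    (1 + prohorovDist (restrictBall x₀ μ r) (restrictBall x₀ ν r)))

/-- The weak-hash distance, the integral of `weakHashIntegrand` over `(0, ∞)`. -/
def weakHashDist (x₀ : X) (μ ν : BoundedlyFiniteIntMeasure X) : ℝ :=
  ∫ r in Ioi (0 : ℝ), weakHashIntegrand x₀ μ ν r

end BoundedlyFiniteIntMeasure

end

/-!
A finite integer-valued Borel measure on a separable metric space is a finite sum of point masses
(`exists_eq_diracSum`): every point of its support is an atom of mass at least one. If two such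
measures have Prohorov distance `< ε ≤ 1`, the additive `ε` in the defining inequalities is absorbed
by integrality, and what is left is Hall's condition; so the measures have equally many atoms, and
these can be matched with displacements below `ε` (`exists_injective_of_prohorovDist_lt`). The
Prohorov distance thus behaves like a bottleneck distance of tuples. This replaces compactness
arguments in the completeness proof: along a fast Cauchy sequence the atoms can be labelled so that
each label converges (`exists_tendsto_diracSum`), and convergence of the atoms passes to the
restrictions to all balls but those with a limit atom on their sphere
(`tendsto_prohorovDist_restrict_ball`).

The integrand is bounded by `e^(-r)`. It is measurable because `r ↦ μ^(r)` is left-continuous on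
sets and the Prohorov distance is determined by countably many inequalities
(`prohorovDist_lt_iff`). If `∑ d#(ξ_n, ξ_(n+1))` is finite, then for almost every `r` the Prohorov
distances of the restrictions are summable (`ae_summable_prohorovDist`). Choosing such radii tending
to infinity gives limits on larger and larger balls; they agree where they overlap, by
left-continuity and because only finitely many radii are exceptional, and so glue to an element of
the space (`exists_glue`). Dominated convergence (`tendsto_weakHashDist_of_ae`) shows that it is the
limit. The same criterion shows that finite sums of point masses at points of a countable dense set
are dense.

For the Borel σ-algebra, evaluation at an open set is lower semicontinuous
(`isClosed_setOf_measure_le`), hence Borel, and a π-λ argument on balls extends this to Borel sets.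
Conversely, for any σ-algebra that makes the evaluations measurable, the distance to a fixed measure
is measurable by joint measurability of the integrand; so balls are measurable, and by separability
all open sets are.
-/

open Filter
open scoped Topology

/-! ### The Prohorov distance of finite measures -/

section Prohorov

variable {X : Type*} [MetricSpace X] [MeasurableSpace X]

lemma prohorovDist_nonneg (μ ν : Measure X) : 0 ≤ prohorovDist μ ν :=
  Real.sInf_nonneg fun _ h => h.1

lemma prohorovDist_le {μ ν : Measure X} {ε : ℝ} (hε : 0 ≤ ε)
    (h : ∀ A : Set X, IsClosed A → μ A ≤ ν (Metric.thickening ε A) + ENNReal.ofReal ε ∧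
      ν A ≤ μ (Metric.thickening ε A) + ENNReal.ofReal ε) : prohorovDist μ ν ≤ ε :=
  csInf_le ⟨0, fun _ hx => hx.1⟩ ⟨hε, h⟩

variable [BorelSpace X]

lemma measure_le_of_prohorovDist_lt {μ ν : Measure X} [IsFiniteMeasure μ] [IsFiniteMeasure ν]
    {ε : ℝ} (h : prohorovDist μ ν < ε) {A : Set X} (hA : MeasurableSet A) :
    μ A ≤ ν (Metric.thickening ε A) + ENNReal.ofReal ε := by
  have h0 : 0 ≤ ε := (prohorovDist_nonneg μ ν).trans h.le
  rw [prohorovDist_eq_levyProkhorovDist] at h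
  have h1 : levyProkhorovEDist μ ν < ENNReal.ofReal ε := by
    rwa [ENNReal.lt_ofReal_iff_toReal_lt (levyProkhorovEDist_ne_top μ ν)]
  have h2 := left_measure_le_of_levyProkhorovEDist_lt h1 hA
  rwa [ENNReal.toReal_ofReal h0] at h2

lemma prohorovDist_self (μ : Measure X) [IsFiniteMeasure μ] : prohorovDist μ μ = 0 := by
  rw [prohorovDist_eq_levyProkhorovDist, levyProkhorovDist_self]

lemma prohorovDist_comm (μ ν : Measure X) [IsFiniteMeasure μ] [IsFiniteMeasure ν] :
    prohorovDist μ ν = prohorovDist ν μ := by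
  rw [prohorovDist_eq_levyProkhorovDist, prohorovDist_eq_levyProkhorovDist,
    levyProkhorovDist_comm]

lemma prohorovDist_triangle (μ ν ρ : Measure X) [IsFiniteMeasure μ] [IsFiniteMeasure ν]
    [IsFiniteMeasure ρ] : prohorovDist μ ρ ≤ prohorovDist μ ν + prohorovDist ν ρ := by
  simp only [prohorovDist_eq_levyProkhorovDist]
  exact levyProkhorovDist_triangle μ ν ρ

lemma eq_of_prohorovDist_eq_zero {μ ν : Measure X} [IsFiniteMeasure μ] [IsFiniteMeasure ν]
    (h : prohorovDist μ ν = 0) : μ = ν := by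
  rw [prohorovDist_eq_levyProkhorovDist, levyProkhorovDist, ENNReal.toReal_eq_zero_iff] at h
  have h' : levyProkhorovEDist μ ν = 0 := h.resolve_right (levyProkhorovEDist_ne_top μ ν)
  have key : ∀ A : Set X, IsClosed A → μ A = ν A := fun A hA =>
    measure_eq_measure_of_levyProkhorovEDist_eq_zero_of_isClosed h' hA
      ⟨1, one_pos, measure_ne_top _ _⟩ ⟨1, one_pos, measure_ne_top _ _⟩
  refine ext_of_generate_finite _ (borel_eq_generateFrom_isClosed (α := X) ▸ BorelSpace.measurable_eq)
    isPiSystem_isClosed (fun A hA => key A hA) (key _ isClosed_univ)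

omit [BorelSpace X] in
/-- An open set is exhausted, for all measures at once, by finite unions of members of a countable
basis. -/
lemma measure_le_of_forall_finset_le {b : ℕ → Set X}
    (hb : IsTopologicalBasis (range b)) (μ : Measure X) {O : Set X} (hO : IsOpen O) {c : ℝ≥0∞}
    (h : ∀ F : Finset ℕ, (⋃ i ∈ F, b i) ⊆ O → μ (⋃ i ∈ F, b i) ≤ c) : μ O ≤ c := by
  classical
  let F : ℕ → Finset ℕ := fun n => (Finset.range n).filter fun i => b i ⊆ O
  have hF : ∀ n, (⋃ i ∈ F n, b i) ⊆ O := fun n =>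
    iUnion₂_subset fun i hi => (Finset.mem_filter.1 hi).2
  have hmono : Monotone fun n => ⋃ i ∈ F n, b i := fun m n hmn =>
    biUnion_subset_biUnion_left fun i hi => by
      have hi' := Finset.mem_filter.1 hi
      exact Finset.mem_filter.2
        ⟨Finset.mem_range.2 ((Finset.mem_range.1 hi'.1).trans_le hmn), hi'.2⟩
  have hU : O = ⋃ n, ⋃ i ∈ F n, b i := by
    refine subset_antisymm (fun x hx => ?_) (iUnion_subset hF)
    obtain ⟨_, ⟨i, rfl⟩, hxi, hi⟩ := hb.exists_subset_of_mem_open hx hO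
    refine mem_iUnion.2 ⟨i + 1, mem_iUnion₂.2 ⟨i, ?_, hxi⟩⟩
    exact Finset.mem_filter.2 ⟨Finset.mem_range.2 (Nat.lt_succ_self i), hi⟩
  rw [hU, hmono.measure_iUnion]
  exact iSup_le fun n => h _ (hF n)

/-- The inequalities defining the Prohorov distance have to be tested only on the countably many
finite unions of basis sets, and only for rational `ε`. -/
lemma prohorovDist_lt_iff {b : ℕ → Set X} (hb : IsTopologicalBasis (range b)) (μ ν : Measure X)
    [IsFiniteMeasure μ] [IsFiniteMeasure ν] (c : ℝ) :
    prohorovDist μ ν < c ↔ ∃ q : ℚ, (0 ≤ (q : ℝ) ∧ (q : ℝ) < c) ∧ ∀ F : Finset ℕ,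
      μ (⋃ i ∈ F, b i) ≤ ν (Metric.thickening q (⋃ i ∈ F, b i)) + ENNReal.ofReal q ∧
      ν (⋃ i ∈ F, b i) ≤ μ (Metric.thickening q (⋃ i ∈ F, b i)) + ENNReal.ofReal q := by
  have hbo : ∀ F : Finset ℕ, IsOpen (⋃ i ∈ F, b i) := fun F =>
    isOpen_biUnion fun i _ => hb.isOpen (mem_range_self i)
  constructor
  · intro h
    obtain ⟨q, hq1, hq2⟩ := exists_rat_btwn h
    refine ⟨q, ⟨(prohorovDist_nonneg _ _).trans hq1.le, hq2⟩, fun F =>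
      ⟨measure_le_of_prohorovDist_lt hq1 (hbo F).measurableSet, ?_⟩⟩
    rw [prohorovDist_comm] at hq1
    exact measure_le_of_prohorovDist_lt hq1 (hbo F).measurableSet
  · rintro ⟨q, ⟨hq0, hqc⟩, h⟩
    obtain ⟨ε, hqε, hεc⟩ := exists_between hqc
    refine lt_of_le_of_lt ?_ hεc
    have aux : ∀ ρ σ : Measure X, (∀ F : Finset ℕ,
        ρ (⋃ i ∈ F, b i) ≤ σ (Metric.thickening q (⋃ i ∈ F, b i)) + ENNReal.ofReal q) →
        ∀ A : Set X, ρ A ≤ σ (Metric.thickening ε A) + ENNReal.ofReal ε := by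
      intro ρ σ hρσ A
      refine (measure_mono (Metric.self_subset_thickening (sub_pos.2 hqε) A)).trans ?_
      refine measure_le_of_forall_finset_le hb ρ Metric.isOpen_thickening fun F hF => ?_
      refine (hρσ F).trans (add_le_add (measure_mono ?_) (ENNReal.ofReal_le_ofReal hqε.le))
      refine (Metric.thickening_subset_of_subset _ hF).trans ?_
      refine (Metric.thickening_thickening_subset _ _ _).trans ?_
      rw [add_sub_cancel]
    exact prohorovDist_le (hq0.trans hqε.le) fun A _ =>
      ⟨aux μ ν (fun F => (h F).1) A, aux ν μ (fun F => (h F).2) A⟩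

lemma measurable_prohorovDist [SeparableSpace X] [Nonempty X] {Ω : Type*} [MeasurableSpace Ω]
    {f g : Ω → Measure X} [∀ ω, IsFiniteMeasure (f ω)] [∀ ω, IsFiniteMeasure (g ω)]
    (hf : Measurable f) (hg : Measurable g) :
    Measurable fun ω => prohorovDist (f ω) (g ω) := by
  have : SecondCountableTopology X := UniformSpace.secondCountable_of_separable X
  obtain ⟨b, hb⟩ : ∃ b : ℕ → Set X, IsTopologicalBasis (range b) := by
    have hne : (countableBasis X).Nonempty :=
      Nonempty.of_sUnion ((isBasis_countableBasis X).sUnion_eq ▸ univ_nonempty)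
    obtain ⟨b, hb⟩ := (countable_countableBasis X).exists_eq_range hne
    exact ⟨b, hb ▸ isBasis_countableBasis X⟩
  refine measurable_of_Iio fun c => ?_
  have : (fun ω => prohorovDist (f ω) (g ω)) ⁻¹' Iio c = ⋃ q : ℚ,
      {ω | 0 ≤ (q : ℝ) ∧ (q : ℝ) < c} ∩ ⋂ F : Finset ℕ,
      {ω | f ω (⋃ i ∈ F, b i) ≤ g ω (Metric.thickening q (⋃ i ∈ F, b i)) + ENNReal.ofReal q} ∩
      {ω | g ω (⋃ i ∈ F, b i) ≤
        f ω (Metric.thickening q (⋃ i ∈ F, b i)) + ENNReal.ofReal q} := by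
    ext ω
    simp only [mem_preimage, mem_Iio, prohorovDist_lt_iff hb, mem_iUnion, mem_inter_iff,
      mem_iInter, mem_ofPred_eq]
  rw [this]
  have hbo : ∀ F : Finset ℕ, MeasurableSet (⋃ i ∈ F, b i) := fun F =>
    (isOpen_biUnion fun i _ => hb.isOpen (mem_range_self i)).measurableSet
  refine MeasurableSet.iUnion fun q => (MeasurableSet.const _).inter <|
    MeasurableSet.iInter fun F => ?_
  have ht : MeasurableSet (Metric.thickening (q : ℝ) (⋃ i ∈ F, b i)) :=
    Metric.isOpen_thickening.measurableSet
  have ev : ∀ {h : Ω → Measure X}, Measurable h → ∀ {A : Set X}, MeasurableSet A →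
      Measurable fun ω => h ω A := fun hh _ hA => (Measure.measurable_coe hA).comp hh
  exact (measurableSet_le (ev hf (hbo F)) ((ev hg ht).add_const _)).inter
    (measurableSet_le (ev hg (hbo F)) ((ev hf ht).add_const _))

/-- Open sets satisfy the portmanteau inequality for Prohorov convergence. -/
lemma measure_le_of_tendsto_prohorovDist {μ : ℕ → Measure X} {ν : Measure X}
    [∀ n, IsFiniteMeasure (μ n)] [IsFiniteMeasure ν]
    (h : Tendsto (fun n => prohorovDist (μ n) ν) atTop (𝓝 0)) {U : Set X} (hU : IsOpen U)
    {c : ℝ≥0∞} (hc : ∀ n, μ n U ≤ c) : ν U ≤ c := by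
  -- the points at distance at least `1 / (j + 1)` from the complement of `U`
  let V : ℕ → Set X := fun j => (Metric.thickening (1 / ((j : ℝ) + 1)) Uᶜ)ᶜ
  have hmono : Monotone V := fun i j hij =>
    compl_subset_compl.2 (Metric.thickening_mono (Nat.one_div_le_one_div hij) _)
  have hVU : U ⊆ ⋃ j, V j := fun x hx => by
    obtain ⟨δ, hδ, hball⟩ := Metric.isOpen_iff.1 hU x hx
    obtain ⟨j, hj⟩ := exists_nat_one_div_lt hδ
    refine mem_iUnion.2 ⟨j, fun hxj => ?_⟩
    obtain ⟨z, hz, hxz⟩ := Metric.mem_thickening_iff.1 hxj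
    exact hz (hball (Metric.mem_ball'.2 (hxz.trans hj)))
  have hthick : ∀ j : ℕ, Metric.thickening (1 / ((j : ℝ) + 1)) (V j) ⊆ U := fun j x hx => by
    by_contra hxU
    obtain ⟨z, hz, hxz⟩ := Metric.mem_thickening_iff.1 hx
    exact hz (Metric.mem_thickening_iff.2 ⟨x, hxU, by rwa [dist_comm]⟩)
  refine (measure_mono hVU).trans ?_
  rw [hmono.measure_iUnion]
  refine iSup_le fun j => ENNReal.le_of_forall_pos_le_add fun ε hε _ => ?_
  have hj : (0 : ℝ) < 1 / ((j : ℝ) + 1) := Nat.one_div_pos_of_nat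
  obtain ⟨n, hn⟩ := (h.eventually_lt_const
    (lt_min (NNReal.coe_pos.2 hε) hj : (0 : ℝ) < min (ε : ℝ) (1 / ((j : ℝ) + 1)))).exists
  rw [prohorovDist_comm] at hn
  refine (measure_le_of_prohorovDist_lt hn
    Metric.isOpen_thickening.isClosed_compl.measurableSet).trans (add_le_add ?_ ?_)
  · exact (measure_mono ((Metric.thickening_mono (min_le_right _ _) _).trans (hthick j))).trans
      (hc n)
  · exact (ENNReal.ofReal_le_ofReal (min_le_left _ _)).trans_eq (ENNReal.ofReal_coe_nnreal)

end Prohorov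

/-! ### Finite integer-valued measures as finite sums of point masses -/

/-- The sum `∑ i, δ_{f i}` of point masses at the entries of the tuple `f`. -/
noncomputable def diracSum {X : Type*} [MeasurableSpace X] {k : ℕ} (f : Fin k → X) : Measure X :=
  ∑ i, Measure.dirac (f i)

section DiracSum

variable {X : Type*} [MeasurableSpace X]

open scoped Classical in
lemma diracSum_apply {k : ℕ} (f : Fin k → X) {A : Set X} (hA : MeasurableSet A) :
    diracSum f A = ((Finset.univ.filter fun i => f i ∈ A).card : ℝ≥0∞) := by
  simp [diracSum, Measure.dirac_apply' _ hA, indicator_apply, Finset.sum_boole]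

instance {k : ℕ} (f : Fin k → X) : IsFiniteMeasure (diracSum f) := by
  constructor
  classical
  rw [diracSum_apply f MeasurableSet.univ]
  exact ENNReal.natCast_lt_top _

lemma exists_natCast_eq_diracSum {k : ℕ} (f : Fin k → X) {A : Set X} (hA : MeasurableSet A) :
    ∃ n : ℕ, diracSum f A = n := by
  classical
  exact ⟨_, diracSum_apply f hA⟩

variable [MetricSpace X] [BorelSpace X]

/-- A point of the support of a finite integer-valued measure is an atom of mass at least one. -/
lemma one_le_measure_singleton_of_mem_support {μ : Measure X} [IsFiniteMeasure μ]
    (hμ : ∀ A, MeasurableSet A → ∃ n : ℕ, μ A = n) {x : X} (hx : x ∈ μ.support) :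
    1 ≤ μ {x} := by
  have h1 : ∀ n : ℕ, 1 ≤ μ (Metric.ball x (1 / (n + 1))) := fun n => by
    have hpos : 0 < μ (Metric.ball x (1 / ((n : ℝ) + 1))) :=
      (Measure.mem_support_iff_forall x).1 hx _ (Metric.ball_mem_nhds x Nat.one_div_pos_of_nat)
    obtain ⟨m, hm⟩ := hμ _ (Metric.isOpen_ball (x := x) (ε := 1 / ((n : ℝ) + 1))).measurableSet
    rw [hm] at hpos ⊢
    exact_mod_cast hpos
  have h2 : {x} = ⋂ n : ℕ, Metric.ball x (1 / ((n : ℝ) + 1)) := by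
    ext y
    simp only [mem_singleton_iff, mem_iInter, Metric.mem_ball]
    refine ⟨fun h n => by rw [h, dist_self]; exact Nat.one_div_pos_of_nat, fun h => ?_⟩
    refine dist_le_zero.1 (le_of_forall_pos_le_add fun δ hδ => ?_)
    obtain ⟨n, hn⟩ := exists_nat_one_div_lt hδ
    rw [zero_add]
    exact ((h n).trans hn).le
  have hanti : Antitone fun n : ℕ => Metric.ball x (1 / ((n : ℝ) + 1)) := fun m n hmn =>
    Metric.ball_subset_ball (Nat.one_div_le_one_div hmn)
  rw [h2, hanti.measure_iInter (fun n => Metric.isOpen_ball.measurableSet.nullMeasurableSet)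
    ⟨0, measure_ne_top _ _⟩]
  exact le_iInf h1

/-- Induction on the total mass, splitting off one atom at a time. -/
lemma exists_eq_diracSum [SeparableSpace X] {μ : Measure X} [IsFiniteMeasure μ]
    (hμ : ∀ A, MeasurableSet A → ∃ n : ℕ, μ A = n) :
    ∃ (k : ℕ) (f : Fin k → X), μ = diracSum f := by
  have : SecondCountableTopology X := UniformSpace.secondCountable_of_separable X
  obtain ⟨n, hn⟩ := hμ univ MeasurableSet.univ
  induction n generalizing μ with
  | zero =>
    refine ⟨0, Fin.elim0, ?_⟩
    have h0 : μ = 0 := Measure.measure_univ_eq_zero.1 (by simpa using hn)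
    simp [h0, diracSum]
  | succ n ih =>
    have hne : μ ≠ 0 := fun h => by
      rw [h] at hn
      simp only [Measure.coe_zero, Pi.zero_apply] at hn
      exact absurd hn.symm (by exact_mod_cast Nat.succ_ne_zero n)
    obtain ⟨x, hx⟩ := Measure.nonempty_support hne
    have h1 := one_le_measure_singleton_of_mem_support hμ hx
    have hle : Measure.dirac x ≤ μ := by
      refine Measure.le_iff.2 fun A hA => ?_
      by_cases hxA : x ∈ A
      · rw [Measure.dirac_apply_of_mem hxA]
        exact h1.trans (measure_mono (singleton_subset_iff.2 hxA))
      · simp [Measure.dirac_apply' x hA, hxA]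
    have hsub : ∀ A, MeasurableSet A → (μ - Measure.dirac x) A = μ A - Measure.dirac x A :=
      fun A hA => Measure.sub_apply hA hle
    obtain ⟨k, f, hf⟩ := ih (μ := μ - Measure.dirac x) (fun A hA => by
      obtain ⟨m, hm⟩ := hμ A hA
      by_cases hxA : x ∈ A
      · refine ⟨m - 1, ?_⟩
        rw [hsub A hA, hm, Measure.dirac_apply_of_mem hxA]
        push_cast
        rfl
      · refine ⟨m, ?_⟩
        simp [hsub A hA, hm, Measure.dirac_apply' x hA, hxA]) (by
      rw [hsub univ MeasurableSet.univ, hn, measure_univ]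
      push_cast
      exact ENNReal.add_sub_cancel_right ENNReal.one_ne_top)
    refine ⟨k + 1, Fin.cons x f, ?_⟩
    rw [← Measure.sub_add_cancel_of_le hle, hf, diracSum, diracSum, Fin.sum_univ_succ, add_comm]
    simp

/-- Point masses that move by less than `ε` without crossing the boundary of `B` move their sum,
restricted to `B`, by at most `ε`. -/
lemma prohorovDist_restrict_diracSum_le {k : ℕ} {f g : Fin k → X} {B : Set X}
    (hB : MeasurableSet B) {ε : ℝ} (hε : 0 ≤ ε) (hfg : ∀ i, dist (f i) (g i) < ε)
    (hmem : ∀ i, f i ∈ B ↔ g i ∈ B) :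
    prohorovDist ((diracSum f).restrict B) ((diracSum g).restrict B) ≤ ε := by
  classical
  have aux : ∀ f g : Fin k → X, (∀ i, dist (f i) (g i) < ε) → (∀ i, f i ∈ B ↔ g i ∈ B) →
      ∀ A : Set X, IsClosed A → (diracSum f).restrict B A ≤
        (diracSum g).restrict B (Metric.thickening ε A) + ENNReal.ofReal ε := by
    intro f g hfg hmem A hA
    refine le_add_right ?_
    rw [Measure.restrict_apply hA.measurableSet,
      Measure.restrict_apply Metric.isOpen_thickening.measurableSet,
      diracSum_apply f (hA.measurableSet.inter hB),
      diracSum_apply g (Metric.isOpen_thickening.measurableSet.inter hB), Nat.cast_le]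
    refine Finset.card_le_card fun i hi => ?_
    simp only [Finset.mem_filter, Finset.mem_univ, true_and, mem_inter_iff] at hi ⊢
    exact ⟨Metric.mem_thickening_iff.2 ⟨f i, hi.1, by rw [dist_comm]; exact hfg i⟩,
      (hmem i).1 hi.2⟩
  exact prohorovDist_le hε fun A hA => ⟨aux f g hfg hmem A hA,
    aux g f (fun i => by rw [dist_comm]; exact hfg i) (fun i => (hmem i).symm) A hA⟩

/-- Below Prohorov distance one, integrality absorbs the additive `ε`, and what remains is Hall's
condition for matching the atoms. -/
lemma exists_injective_of_prohorovDist_lt {k l : ℕ} {f : Fin k → X} {g : Fin l → X} {ε : ℝ}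
    (hε : ε ≤ 1) (h : prohorovDist (diracSum f) (diracSum g) < ε) :
    ∃ σ : Fin k → Fin l, Function.Injective σ ∧ ∀ i, dist (f i) (g (σ i)) < ε := by
  classical
  obtain ⟨δ, hδ, hδε⟩ := exists_between h
  have hall := (Finset.all_card_le_biUnion_card_iff_exists_injective
    (fun i : Fin k => Finset.univ.filter fun j : Fin l => dist (f i) (g j) < ε)).1 fun S => by
      have hA : IsClosed (f '' (S : Set (Fin k))) := (S.finite_toSet.image f).isClosed
      have h1 := measure_le_of_prohorovDist_lt hδ hA.measurableSet
      rw [diracSum_apply f hA.measurableSet,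
        diracSum_apply g Metric.isOpen_thickening.measurableSet] at h1
      set m := (Finset.univ.filter fun i => f i ∈ f '' (S : Set (Fin k))).card with hm
      set n := (Finset.univ.filter fun j => g j ∈ Metric.thickening δ (f '' (S : Set (Fin k)))).card
        with hn
      have h2 : S.card ≤ m := Finset.card_le_card fun i hi =>
        Finset.mem_filter.2 ⟨Finset.mem_univ i, mem_image_of_mem f hi⟩
      have h3 : m ≤ n := by
        have : (m : ℝ≥0∞) < (n : ℝ≥0∞) + 1 := h1.trans_lt <|
          ENNReal.add_lt_add_left (ENNReal.natCast_ne_top n) <|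
            ENNReal.ofReal_lt_one.2 (hδε.trans_le hε)
        have : m < n + 1 := by exact_mod_cast this
        omega
      refine h2.trans (h3.trans (Finset.card_le_card fun j hj => ?_))
      obtain ⟨_, ⟨i, hi, rfl⟩, hij⟩ := Metric.mem_thickening_iff.1 (Finset.mem_filter.1 hj).2
      refine Finset.mem_biUnion.2 ⟨i, hi, Finset.mem_filter.2 ⟨Finset.mem_univ j, ?_⟩⟩
      rw [dist_comm]
      exact hij.trans hδε
  obtain ⟨σ, hσ, hσ'⟩ := hall
  exact ⟨σ, hσ, fun i => (Finset.mem_filter.1 (hσ' i)).2⟩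

lemma exists_diracSum_of_prohorovDist_lt [SeparableSpace X] {k : ℕ} {f : Fin k → X}
    {ν : Measure X} [IsFiniteMeasure ν] (hν : ∀ A, MeasurableSet A → ∃ n : ℕ, ν A = n)
    {ε : ℝ} (h1 : prohorovDist (diracSum f) ν < 1) (hε : prohorovDist (diracSum f) ν < ε) :
    ∃ g : Fin k → X, ν = diracSum g ∧ ∀ i, dist (f i) (g i) < ε := by
  obtain ⟨l, g, rfl⟩ := exists_eq_diracSum hν
  obtain ⟨σ, hσ, hd⟩ := exists_injective_of_prohorovDist_lt (min_le_right ε 1) (lt_min hε h1)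
  rw [prohorovDist_comm] at h1
  obtain ⟨τ, hτ, -⟩ := exists_injective_of_prohorovDist_lt le_rfl h1
  have hkl : k = l := le_antisymm (by simpa using Fintype.card_le_of_injective σ hσ)
    (by simpa using Fintype.card_le_of_injective τ hτ)
  subst hkl
  have hbij : Function.Bijective σ := Finite.injective_iff_bijective.1 hσ
  exact ⟨g ∘ σ, (Function.Bijective.sum_comp hbij fun j => Measure.dirac (g j)).symm,
    fun i => (hd i).trans_le (min_le_left _ _)⟩

/-- The atoms of a fast Cauchy sequence of finite integer-valued measures can be labelled so that
each label converges. -/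
lemma exists_tendsto_diracSum [CompleteSpace X] [SeparableSpace X] {μ : ℕ → Measure X}
    [∀ n, IsFiniteMeasure (μ n)] (hμ : ∀ n A, MeasurableSet A → ∃ m : ℕ, μ n A = m)
    (hs : Summable fun n => prohorovDist (μ n) (μ (n + 1))) :
    ∃ (k N : ℕ) (f : Fin k → X) (y : ℕ → Fin k → X), (∀ n, μ (n + N) = diracSum (y n)) ∧
      ∀ i, Tendsto (fun n => y n i) atTop (𝓝 (f i)) := by
  -- matching the atoms requires consecutive Prohorov distances below one
  obtain ⟨N, hN⟩ := eventually_atTop.1 (hs.tendsto_atTop_zero.eventually_lt_const one_pos)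
  obtain ⟨k, f₀, hf₀⟩ := exists_eq_diracSum (hμ N)
  have step : ∀ (n : ℕ) (g : Fin k → X), μ (n + N) = diracSum g → ∃ g' : Fin k → X,
      μ (n + 1 + N) = diracSum g' ∧ ∀ i, dist (g i) (g' i) <
        prohorovDist (μ (n + N)) (μ (n + N + 1)) + (1 / 2) ^ n := by
    intro n g hg
    have e : n + 1 + N = n + N + 1 := by omega
    rw [e]
    have h1 := hN (n + N) (Nat.le_add_left _ _)
    rw [hg] at h1 ⊢
    exact exists_diracSum_of_prohorovDist_lt (hμ _) h1 (lt_add_of_pos_right _ (by positivity))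
  choose! s hs1 hs2 using step
  let y : ℕ → Fin k → X := fun n => Nat.rec f₀ s n
  have hy : ∀ n, μ (n + N) = diracSum (y n) := by
    intro n
    induction n with
    | zero => exact (congrArg μ (Nat.zero_add N)).trans hf₀
    | succ n ih => exact hs1 n _ ih
  have hsum : Summable fun n : ℕ =>
      prohorovDist (μ (n + N)) (μ (n + N + 1)) + (1 / 2 : ℝ) ^ n :=
    ((summable_nat_add_iff (f := fun n => prohorovDist (μ n) (μ (n + 1))) N).2 hs).add
      summable_geometric_two
  have hc : ∀ i, ∃ x, Tendsto (fun n => y n i) atTop (𝓝 x) := fun i =>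
    cauchySeq_tendsto_of_complete
      (cauchySeq_of_dist_le_of_summable _ (fun n => (hs2 n _ (hy n) i).le) hsum)
  choose f hf using hc
  exact ⟨k, N, f, y, hy, hf⟩

/-- Off the finitely many radii at which a limit atom lies on the sphere, convergence of the atoms
passes to the restrictions to balls. -/
lemma tendsto_prohorovDist_restrict_ball {k : ℕ} {f : Fin k → X} {y : ℕ → Fin k → X}
    (hy : ∀ i, Tendsto (fun n => y n i) atTop (𝓝 (f i))) (x₀ : X) {r : ℝ}
    (hr : ∀ i, dist (f i) x₀ ≠ r) :
    Tendsto (fun n => prohorovDist ((diracSum (y n)).restrict (Metric.ball x₀ r))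
      ((diracSum f).restrict (Metric.ball x₀ r))) atTop (𝓝 0) := by
  have hmem : ∀ᶠ n in atTop, ∀ i, y n i ∈ Metric.ball x₀ r ↔ f i ∈ Metric.ball x₀ r := by
    refine eventually_all.2 fun i => ?_
    have hd : Tendsto (fun n => dist (y n i) x₀) atTop (𝓝 (dist (f i) x₀)) :=
      (hy i).dist tendsto_const_nhds
    rcases (hr i).lt_or_gt with h | h
    · filter_upwards [hd.eventually_lt_const h] with n hn
      simp [Metric.mem_ball, hn, h]
    · filter_upwards [hd.eventually_const_lt h] with n hn
      simp only [Metric.mem_ball, hn.not_gt, h.not_gt]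
  refine tendsto_order.2 ⟨fun a ha => Eventually.of_forall fun n =>
    ha.trans_le (prohorovDist_nonneg _ _), fun a ha => ?_⟩
  have hdist : ∀ᶠ n in atTop, ∀ i, dist (y n i) (f i) < a / 2 :=
    eventually_all.2 fun i => (Metric.tendsto_nhds.1 (hy i)) _ (half_pos ha)
  filter_upwards [hmem, hdist] with n h1 h2
  exact (prohorovDist_restrict_diracSum_le Metric.isOpen_ball.measurableSet (half_pos ha).le
    h2 h1).trans_lt (half_lt_self ha)

end DiracSum

/-! ### Restrictions to balls and the integrand -/

namespace BoundedlyFiniteIntMeasure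

section Basic

variable {X : Type*} [MetricSpace X] [MeasurableSpace X]

lemma toMeasure_injective : Function.Injective (toMeasure : BoundedlyFiniteIntMeasure X → _) := by
  rintro ⟨μ, _, _⟩ ⟨ν, _, _⟩ rfl
  rfl

variable [BorelSpace X] (x₀ : X)

instance (ξ : BoundedlyFiniteIntMeasure X) (r : ℝ) : IsFiniteMeasure (restrictBall x₀ ξ r) := by
  constructor
  rw [restrictBall, Measure.restrict_apply_univ]
  exact ξ.lt_top_of_isBounded _ Metric.isOpen_ball.measurableSet Metric.isBounded_ball

omit [BorelSpace X] in
lemma restrictBall_apply (ξ : BoundedlyFiniteIntMeasure X) (r : ℝ) {A : Set X}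
    (hA : MeasurableSet A) : restrictBall x₀ ξ r A = ξ.toMeasure (A ∩ Metric.ball x₀ r) :=
  Measure.restrict_apply hA

lemma exists_natCast_eq_restrictBall (ξ : BoundedlyFiniteIntMeasure X) (r : ℝ) {A : Set X}
    (hA : MeasurableSet A) : ∃ n : ℕ, restrictBall x₀ ξ r A = n := by
  refine (ξ.integer_valued _ (hA.inter Metric.isOpen_ball.measurableSet)).elim (fun h => ?_)
    fun ⟨n, hn⟩ => ⟨n, (restrictBall_apply x₀ ξ r hA).trans hn⟩
  exact absurd ((restrictBall_apply x₀ ξ r hA).trans h) (measure_ne_top _ _)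

lemma restrictBall_restrict_ball (ξ : BoundedlyFiniteIntMeasure X) {r R : ℝ} (h : r ≤ R) :
    (restrictBall x₀ ξ R).restrict (Metric.ball x₀ r) = restrictBall x₀ ξ r := by
  rw [restrictBall, Measure.restrict_restrict Metric.isOpen_ball.measurableSet,
    inter_eq_left.2 (Metric.ball_subset_ball h), restrictBall]

omit [MeasurableSpace X] [BorelSpace X] in
/-- Open balls are exhausted from the inside by balls of rational radius. -/
lemma ball_eq_iUnion_rat (r : ℝ) :
    Metric.ball x₀ r = ⋃ q : {q : ℚ // (q : ℝ) < r}, Metric.ball x₀ (q : ℝ) := by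
  refine subset_antisymm (fun x hx => ?_)
    (iUnion_subset fun q => Metric.ball_subset_ball q.2.le)
  obtain ⟨q, hq1, hq2⟩ := exists_rat_btwn (Metric.mem_ball.1 hx)
  exact mem_iUnion.2 ⟨⟨q, hq2⟩, hq1⟩

omit [BorelSpace X] in
/-- The restrictions to balls are left-continuous in the radius. -/
lemma measure_inter_ball_eq_iSup (μ : Measure X) (A : Set X) (r : ℝ) :
    μ (A ∩ Metric.ball x₀ r) = ⨆ q : ℚ, ⨆ _ : (q : ℝ) < r, μ (A ∩ Metric.ball x₀ (q : ℝ)) := by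
  rw [ball_eq_iUnion_rat, inter_iUnion, Directed.measure_iUnion, iSup_subtype]
  refine directed_of_isDirected_le fun p q hpq => inter_subset_inter_right _ <|
    Metric.ball_subset_ball ?_
  exact_mod_cast hpq

omit [BorelSpace X] in
lemma measure_le_of_frequently_restrictBall_le {ξ : BoundedlyFiniteIntMeasure X} {A : Set X}
    (hA : MeasurableSet A) {c : ℝ≥0∞} (h : ∃ᶠ r in atTop, restrictBall x₀ ξ r A ≤ c) :
    ξ.toMeasure A ≤ c := by
  have hU : A = ⋃ n : ℕ, A ∩ Metric.ball x₀ (n : ℝ) := by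
    rw [← inter_iUnion, Metric.iUnion_ball_nat, inter_univ]
  have hmono : Monotone fun n : ℕ => A ∩ Metric.ball x₀ (n : ℝ) := fun m n hmn =>
    inter_subset_inter_right _ (Metric.ball_subset_ball (by exact_mod_cast hmn))
  rw [hU, hmono.measure_iUnion]
  refine iSup_le fun n => ?_
  obtain ⟨r, hr, hn⟩ := (h.and_eventually (eventually_ge_atTop (n : ℝ))).exists
  rw [restrictBall_apply x₀ ξ r hA] at hr
  exact (measure_mono (inter_subset_inter_right _ (Metric.ball_subset_ball hn))).trans hr

omit [BorelSpace X] in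
lemma ext_of_frequently_restrictBall_eq {ξ ζ : BoundedlyFiniteIntMeasure X}
    (h : ∃ᶠ r in atTop, restrictBall x₀ ξ r = restrictBall x₀ ζ r) : ξ = ζ := by
  have aux : ∀ ξ ζ : BoundedlyFiniteIntMeasure X,
      (∃ᶠ r in atTop, restrictBall x₀ ξ r = restrictBall x₀ ζ r) → ξ.toMeasure ≤ ζ.toMeasure :=
    fun ξ ζ h => Measure.le_iff.2 fun A hA => measure_le_of_frequently_restrictBall_le x₀ hA <|
      h.mono fun r hr => hr ▸ Measure.restrict_apply_le _ _
  exact toMeasure_injective (le_antisymm (aux _ _ h) (aux _ _ (h.mono fun _ => Eq.symm)))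

/-- Restrictions to balls are jointly measurable in the measure and the radius: left-continuity in
the radius reduces this to rational radii. -/
lemma measurable_restrictBall {Ω : Type*} [MeasurableSpace Ω]
    {ζ : Ω → BoundedlyFiniteIntMeasure X}
    (hζ : ∀ A, MeasurableSet A → Measurable fun ω => (ζ ω).toMeasure A) :
    Measurable fun p : Ω × ℝ => restrictBall x₀ (ζ p.1) p.2 := by
  refine Measure.measurable_of_measurable_coe _ fun A hA => ?_
  have : (fun p : Ω × ℝ => restrictBall x₀ (ζ p.1) p.2 A) = fun p => ⨆ q : ℚ,
      {p : Ω × ℝ | (q : ℝ) < p.2}.indicator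
        (fun p => (ζ p.1).toMeasure (A ∩ Metric.ball x₀ (q : ℝ))) p := by
    ext p
    rw [restrictBall_apply x₀ _ _ hA, measure_inter_ball_eq_iSup]
    refine iSup_congr fun q => ?_
    by_cases hq : (q : ℝ) < p.2 <;> simp [hq]
  rw [this]
  exact Measurable.iSup fun q => Measurable.indicator
    ((hζ _ (hA.inter Metric.isOpen_ball.measurableSet)).comp measurable_fst)
    (measurableSet_lt measurable_const measurable_snd)

/-! ### The weak-hash distance -/

omit [BorelSpace X] in
lemma weakHashIntegrand_nonneg (μ ν : BoundedlyFiniteIntMeasure X) (r : ℝ) :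
    0 ≤ weakHashIntegrand x₀ μ ν r := by
  have := prohorovDist_nonneg (restrictBall x₀ μ r) (restrictBall x₀ ν r)
  unfold weakHashIntegrand
  positivity

omit [BorelSpace X] in
lemma weakHashIntegrand_le (μ ν : BoundedlyFiniteIntMeasure X) (r : ℝ) :
    weakHashIntegrand x₀ μ ν r ≤ Real.exp (-r) := by
  have := prohorovDist_nonneg (restrictBall x₀ μ r) (restrictBall x₀ ν r)
  refine mul_le_of_le_one_right (Real.exp_nonneg _) ?_
  exact div_le_one_of_le₀ (by linarith) (by linarith)

/-- The measures depend on a parameter from an arbitrary measurable space. A one-point parameter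
space gives integrability in the radius; taking for it the space of measures itself, with a σ-algebra
that makes the evaluations measurable, gives measurability of the distance to `ν`. -/
lemma measurable_weakHashIntegrand [SeparableSpace X] {Ω : Type*} [MeasurableSpace Ω]
    {ζ : Ω → BoundedlyFiniteIntMeasure X}
    (hζ : ∀ A, MeasurableSet A → Measurable fun ω => (ζ ω).toMeasure A)
    (ν : BoundedlyFiniteIntMeasure X) :
    Measurable fun p : Ω × ℝ => weakHashIntegrand x₀ (ζ p.1) ν p.2 := by
  have : Nonempty X := ⟨x₀⟩
  have hd : Measurable fun p : Ω × ℝ =>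
      prohorovDist (restrictBall x₀ (ζ p.1) p.2) (restrictBall x₀ ν p.2) :=
    measurable_prohorovDist (measurable_restrictBall x₀ hζ)
      (measurable_restrictBall x₀ (ζ := fun _ : Ω => ν) fun A _ => measurable_const)
  exact (Real.measurable_exp.comp measurable_snd.neg).mul (hd.div (hd.const_add 1))

lemma measurable_weakHashIntegrand_right [SeparableSpace X] (μ ν : BoundedlyFiniteIntMeasure X) :
    Measurable (weakHashIntegrand x₀ μ ν) :=
  (measurable_weakHashIntegrand x₀ (ζ := fun _ : Unit => μ) (fun _ _ => measurable_const)
    ν).comp (measurable_const (a := ()).prodMk measurable_id)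

lemma integrableOn_weakHashIntegrand [SeparableSpace X] (μ ν : BoundedlyFiniteIntMeasure X) :
    IntegrableOn (weakHashIntegrand x₀ μ ν) (Ioi 0) :=
  (integrableOn_exp_neg_Ioi 0).mono' (measurable_weakHashIntegrand_right x₀ μ ν).aestronglyMeasurable <|
    ae_of_all _ fun r => by
      rw [Real.norm_of_nonneg (weakHashIntegrand_nonneg x₀ μ ν r)]
      exact weakHashIntegrand_le x₀ μ ν r

omit [BorelSpace X] in
lemma weakHashDist_nonneg (μ ν : BoundedlyFiniteIntMeasure X) : 0 ≤ weakHashDist x₀ μ ν :=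
  integral_nonneg fun r => weakHashIntegrand_nonneg x₀ μ ν r

lemma weakHashDist_self (μ : BoundedlyFiniteIntMeasure X) : weakHashDist x₀ μ μ = 0 := by
  simp [weakHashDist, weakHashIntegrand, prohorovDist_self]

lemma weakHashDist_comm (μ ν : BoundedlyFiniteIntMeasure X) :
    weakHashDist x₀ μ ν = weakHashDist x₀ ν μ := by
  simp only [weakHashDist, weakHashIntegrand]
  simp_rw [prohorovDist_comm (restrictBall x₀ μ _) (restrictBall x₀ ν _)]

omit [MeasurableSpace X] [MetricSpace X] [BorelSpace X] in
/-- The function `t ↦ t / (1 + t)` is monotone and subadditive. -/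
lemma div_one_add_le_add {a b c : ℝ} (ha : 0 ≤ a) (hb : 0 ≤ b) (hc : 0 ≤ c) (h : c ≤ a + b) :
    c / (1 + c) ≤ a / (1 + a) + b / (1 + b) := by
  have h1 : c / (1 + c) ≤ (a + b) / (1 + (a + b)) := by
    rw [div_le_div_iff₀ (by positivity) (by positivity)]
    nlinarith
  refine h1.trans ?_
  rw [add_div]
  exact add_le_add (div_le_div_of_nonneg_left ha (by positivity) (by linarith))
    (div_le_div_of_nonneg_left hb (by positivity) (by linarith))

lemma weakHashDist_triangle [SeparableSpace X] (μ ν ρ : BoundedlyFiniteIntMeasure X) :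
    weakHashDist x₀ μ ρ ≤ weakHashDist x₀ μ ν + weakHashDist x₀ ν ρ := by
  simp only [weakHashDist]
  rw [← integral_add (integrableOn_weakHashIntegrand x₀ μ ν)
    (integrableOn_weakHashIntegrand x₀ ν ρ)]
  refine integral_mono (integrableOn_weakHashIntegrand x₀ μ ρ)
    ((integrableOn_weakHashIntegrand x₀ μ ν).add (integrableOn_weakHashIntegrand x₀ ν ρ))
    fun r => ?_
  simp only [weakHashIntegrand, ← mul_add]
  exact mul_le_mul_of_nonneg_left (div_one_add_le_add (prohorovDist_nonneg _ _)
    (prohorovDist_nonneg _ _) (prohorovDist_nonneg _ _) (prohorovDist_triangle _ _ _))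
    (Real.exp_nonneg _)

omit [MetricSpace X] [MeasurableSpace X] [BorelSpace X] in
lemma frequently_atTop_of_ae {p : ℝ → Prop} (h : ∀ᵐ r ∂volume.restrict (Ioi (0 : ℝ)), p r) :
    ∃ᶠ r in atTop, p r := by
  refine frequently_atTop.2 fun a => ?_
  have h1 : ∀ᵐ r ∂volume.restrict (Ioi (max a 0)), p r :=
    ae_restrict_of_ae_restrict_of_subset (Ioi_subset_Ioi (le_max_right a 0)) h
  rw [ae_restrict_iff' measurableSet_Ioi] at h1
  have : (volume (Ioi (max a 0)) : ℝ≥0∞) ≠ 0 := by simp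
  obtain ⟨r, hr, hr'⟩ := ((frequently_ae_mem_iff.2 this).and_eventually h1).exists
  exact ⟨r, (le_max_left a 0).trans (le_of_lt hr), hr' hr⟩

omit [BorelSpace X] in
lemma weakHashIntegrand_eq_zero_iff {μ ν : BoundedlyFiniteIntMeasure X} {r : ℝ} :
    weakHashIntegrand x₀ μ ν r = 0 ↔
      prohorovDist (restrictBall x₀ μ r) (restrictBall x₀ ν r) = 0 := by
  have := prohorovDist_nonneg (restrictBall x₀ μ r) (restrictBall x₀ ν r)
  have h1 : 1 + prohorovDist (restrictBall x₀ μ r) (restrictBall x₀ ν r) ≠ 0 := by linarith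
  simp [weakHashIntegrand, h1]

lemma eq_of_weakHashDist_eq_zero [SeparableSpace X] {μ ν : BoundedlyFiniteIntMeasure X}
    (h : weakHashDist x₀ μ ν = 0) : μ = ν := by
  have h1 := (integral_eq_zero_iff_of_nonneg (weakHashIntegrand_nonneg x₀ μ ν)
    (integrableOn_weakHashIntegrand x₀ μ ν)).1 h
  refine ext_of_frequently_restrictBall_eq x₀ (frequently_atTop_of_ae (h1.mono fun r hr => ?_))
  exact eq_of_prohorovDist_eq_zero ((weakHashIntegrand_eq_zero_iff x₀).1 hr)

/-- The weak-hash distance as a metric. It is not an instance, since it depends on the origin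
`x₀`. -/
@[reducible]
noncomputable def weakHashMetricSpace [SeparableSpace X] :
    MetricSpace (BoundedlyFiniteIntMeasure X) where
  dist := weakHashDist x₀
  dist_self := weakHashDist_self x₀
  dist_comm := weakHashDist_comm x₀
  dist_triangle := weakHashDist_triangle x₀
  eq_of_dist_eq_zero := eq_of_weakHashDist_eq_zero x₀

/-- Prohorov convergence of the restrictions for almost every radius implies weak-hash
convergence, by dominated convergence. -/
lemma tendsto_weakHashDist_of_ae [SeparableSpace X] {u : ℕ → BoundedlyFiniteIntMeasure X}
    {ξ : BoundedlyFiniteIntMeasure X} (h : ∀ᵐ r ∂volume.restrict (Ioi (0 : ℝ)),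
      Tendsto (fun n => prohorovDist (restrictBall x₀ (u n) r) (restrictBall x₀ ξ r)) atTop (𝓝 0)) :
    Tendsto (fun n => weakHashDist x₀ (u n) ξ) atTop (𝓝 0) := by
  have := tendsto_integral_of_dominated_convergence (μ := volume.restrict (Ioi (0 : ℝ)))
    (F := fun n => weakHashIntegrand x₀ (u n) ξ) (f := fun _ => 0) (fun r => Real.exp (-r))
    (fun n => (measurable_weakHashIntegrand_right x₀ (u n) ξ).aestronglyMeasurable)
    (integrableOn_exp_neg_Ioi 0) (fun n => ae_of_all _ fun r => by
      rw [Real.norm_of_nonneg (weakHashIntegrand_nonneg x₀ _ _ r)]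
      exact weakHashIntegrand_le x₀ _ _ r) (h.mono fun r hr => by
      have := (hr.div (hr.const_add 1) (by norm_num)).const_mul (Real.exp (-r))
      simpa [weakHashIntegrand] using this)
  simpa [weakHashDist] using this

/-- A sum of weak-hash distances dominates, for almost every radius, the sum of the Prohorov
distances of the restrictions. -/
lemma ae_summable_prohorovDist [SeparableSpace X] {u v : ℕ → BoundedlyFiniteIntMeasure X}
    (h : Summable fun n => weakHashDist x₀ (u n) (v n)) :
    ∀ᵐ r ∂volume.restrict (Ioi (0 : ℝ)),
      Summable fun n => prohorovDist (restrictBall x₀ (u n) r) (restrictBall x₀ (v n) r) := by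
  have hfin : ∫⁻ r in Ioi (0 : ℝ),
      ∑' n, ENNReal.ofReal (weakHashIntegrand x₀ (u n) (v n) r) ≠ ∞ := by
    rw [lintegral_tsum fun n =>
      (measurable_weakHashIntegrand_right x₀ (u n) (v n)).ennreal_ofReal.aemeasurable]
    simp_rw [← ofReal_integral_eq_lintegral_ofReal (integrableOn_weakHashIntegrand x₀ _ _)
      (ae_of_all _ (weakHashIntegrand_nonneg x₀ _ _))]
    exact h.tsum_ofReal_ne_top
  have hmeas : Measurable fun r =>
      ∑' n, ENNReal.ofReal (weakHashIntegrand x₀ (u n) (v n) r) :=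
    Measurable.tsum fun n =>
      (measurable_weakHashIntegrand_right x₀ (u n) (v n)).ennreal_ofReal
  filter_upwards [ae_lt_top hmeas hfin] with r hr
  have hs : Summable fun n => weakHashIntegrand x₀ (u n) (v n) r := by
    have := ENNReal.summable_toReal hr.ne
    simpa [ENNReal.toReal_ofReal (weakHashIntegrand_nonneg x₀ _ _ r)] using this
  have hs' : Summable fun n => prohorovDist (restrictBall x₀ (u n) r) (restrictBall x₀ (v n) r) /
      (1 + prohorovDist (restrictBall x₀ (u n) r) (restrictBall x₀ (v n) r)) :=
    (summable_mul_left_iff (Real.exp_ne_zero (-r))).1 hs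
  refine summable_of_isBigO_nat' (hs'.mul_left 2) (Asymptotics.IsBigO.of_bound 1 ?_)
  filter_upwards [hs'.tendsto_atTop_zero.eventually_lt_const (show (0 : ℝ) < 1 / 2 by norm_num)]
    with n hn
  -- where `d / (1 + d) < 1 / 2`, it is at least `d / 2`
  have h0 := prohorovDist_nonneg (restrictBall x₀ (u n) r) (restrictBall x₀ (v n) r)
  set d := prohorovDist (restrictBall x₀ (u n) r) (restrictBall x₀ (v n) r)
  rw [div_lt_iff₀ (by linarith)] at hn
  rw [Real.norm_of_nonneg h0, Real.norm_of_nonneg (by positivity), one_mul, ← mul_div_assoc,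
    le_div_iff₀ (by linarith)]
  nlinarith

end Basic

/-! ### Separability -/

section Separable

variable {X : Type*} [MetricSpace X] [MeasurableSpace X]

/-- The sum of the point masses at the entries of a tuple, as a boundedly finite integer-valued
measure. -/
noncomputable def ofTuple {k : ℕ} (f : Fin k → X) : BoundedlyFiniteIntMeasure X where
  toMeasure := diracSum f
  lt_top_of_isBounded _ _ _ := measure_lt_top _ _
  integer_valued _ hA := Or.inr (exists_natCast_eq_diracSum f hA)

variable [BorelSpace X] [SeparableSpace X] (x₀ : X)

/-- Sums of point masses depend continuously on the atoms. -/
lemma tendsto_weakHashDist_ofTuple {k : ℕ} {f : Fin k → X} {y : ℕ → Fin k → X}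
    (hy : ∀ i, Tendsto (fun n => y n i) atTop (𝓝 (f i))) :
    Tendsto (fun n => weakHashDist x₀ (ofTuple (y n)) (ofTuple f)) atTop (𝓝 0) := by
  refine tendsto_weakHashDist_of_ae x₀ (ae_restrict_of_ae ?_)
  have hae : ∀ᵐ r ∂(volume : Measure ℝ), r ∉ range fun i => dist (f i) x₀ :=
    (finite_range _).countable.ae_notMem _
  filter_upwards [hae] with r hr
  exact tendsto_prohorovDist_restrict_ball hy x₀ fun i hi => hr ⟨i, hi⟩

/-- Every measure in the space is the limit of its restrictions to balls, which are finite sums of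
point masses. -/
lemma exists_tendsto_weakHashDist_ofTuple (ξ : BoundedlyFiniteIntMeasure X) :
    ∃ (k : ℕ → ℕ) (f : ∀ n, Fin (k n) → X),
      Tendsto (fun n => weakHashDist x₀ (ofTuple (f n)) ξ) atTop (𝓝 0) := by
  have h : ∀ n : ℕ, ∃ (k : ℕ) (f : Fin k → X), restrictBall x₀ ξ n = diracSum f := fun n =>
    exists_eq_diracSum fun _ hA => exists_natCast_eq_restrictBall x₀ ξ n hA
  choose k f hf using h
  refine ⟨k, f, tendsto_weakHashDist_of_ae x₀ (ae_of_all _ fun r => ?_)⟩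
  refine tendsto_const_nhds.congr' ?_
  filter_upwards [eventually_ge_atTop ⌈r⌉₊] with n hn
  have : restrictBall x₀ (ofTuple (f n)) r = restrictBall x₀ ξ r := by
    rw [← restrictBall_restrict_ball x₀ ξ (Nat.ceil_le.1 hn), hf]
    rfl
  rw [this, prohorovDist_self]

lemma separableSpace_weakHash :
    letI := weakHashMetricSpace x₀
    SeparableSpace (BoundedlyFiniteIntMeasure X) := by
  let _ := weakHashMetricSpace x₀
  have : Nonempty X := ⟨x₀⟩
  let S : Set (BoundedlyFiniteIntMeasure X) :=
    range fun p : Σ k, Fin k → ℕ => ofTuple fun i => denseSeq X (p.2 i)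
  have htuple : ∀ {k : ℕ} (f : Fin k → X), ofTuple f ∈ closure S := by
    intro k f
    have h : ∀ i, ∃ j : ℕ → ℕ, Tendsto (fun n => denseSeq X (j n)) atTop (𝓝 (f i)) := fun i => by
      obtain ⟨z, hz, hlim⟩ := mem_closure_iff_seq_limit.1 (denseRange_denseSeq X (f i))
      choose j hj using hz
      exact ⟨j, by simpa only [hj] using hlim⟩
    choose j hj using h
    refine mem_closure_of_tendsto (tendsto_iff_dist_tendsto_zero.2
      (tendsto_weakHashDist_ofTuple x₀ hj)) (Eventually.of_forall fun n => ?_)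
    exact ⟨⟨k, fun i => j i n⟩, rfl⟩
  refine ⟨S, countable_range _, fun ξ => ?_⟩
  obtain ⟨k, f, hf⟩ := exists_tendsto_weakHashDist_ofTuple x₀ ξ
  exact isClosed_closure.mem_of_tendsto (tendsto_iff_dist_tendsto_zero.2 hf)
    (Eventually.of_forall fun n => htuple (f n))

end Separable

/-! ### Completeness -/

section Complete

variable {X : Type*} [MetricSpace X] [MeasurableSpace X]

omit [MetricSpace X] [MeasurableSpace X] in
lemma tsum_eq_top_or_natCast {a : ℕ → ℝ≥0∞} (ha : ∀ m, ∃ n : ℕ, a m = n) :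
    ∑' m, a m = ∞ ∨ ∃ n : ℕ, ∑' m, a m = n := by
  refine or_iff_not_imp_left.2 fun h => ?_
  have hfin : {m | ¬ a m < 1}.Finite := eventually_cofinite.1
    ((ENNReal.tendsto_cofinite_zero_of_tsum_ne_top h).eventually_lt_const one_pos)
  choose n hn using ha
  refine ⟨∑ m ∈ hfin.toFinset, n m, ?_⟩
  rw [tsum_eq_sum (s := hfin.toFinset) fun m hm => ?_]
  · simp [hn]
  · have : a m < 1 := by simpa using hm
    rw [hn] at this ⊢
    have : n m < 1 := by exact_mod_cast this
    simp [Nat.lt_one_iff.1 this]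

variable [BorelSpace X] (x₀ : X)

/-- Measures `η m` that agree on the intersections of the balls of radius `m` glue. The glued
measure is the sum of the restrictions of `η m` to the successive shells. -/
lemma exists_glue {η : ℕ → Measure X} [∀ m, IsFiniteMeasure (η m)]
    (hη : ∀ m A, MeasurableSet A → ∃ n : ℕ, η m A = n)
    (hcons : ∀ (m M : ℕ) (A : Set X), MeasurableSet A → A ⊆ Metric.ball x₀ (m : ℝ) →
      A ⊆ Metric.ball x₀ (M : ℝ) → η m A = η M A) :
    ∃ ξ : BoundedlyFiniteIntMeasure X, ∀ (m : ℕ) (r : ℝ), r ≤ m →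
      restrictBall x₀ ξ r = (η m).restrict (Metric.ball x₀ r) := by
  let D : ℕ → Set X := disjointed fun m : ℕ => Metric.ball x₀ (m : ℝ)
  have hD : ∀ m, MeasurableSet (D m) := fun m =>
    MeasurableSet.disjointed (fun _ => Metric.isOpen_ball.measurableSet) m
  have hDball : ∀ m, D m ⊆ Metric.ball x₀ (m : ℝ) := fun m => disjointed_subset _ m
  have hDU : ⋃ m, D m = univ := by
    rw [iUnion_disjointed, Metric.iUnion_ball_nat]
  let ζ : Measure X := Measure.sum fun m => (η m).restrict (D m)
  have hζ : ∀ A, MeasurableSet A → ζ A = ∑' m, η m (A ∩ D m) := fun A hA => by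
    rw [Measure.sum_apply _ hA]
    exact tsum_congr fun m => Measure.restrict_apply hA
  have hloc : ∀ (M : ℕ) (A : Set X), MeasurableSet A → A ⊆ Metric.ball x₀ (M : ℝ) →
      ζ A = η M A := by
    intro M A hA hAM
    rw [hζ A hA, tsum_congr fun m => hcons m M (A ∩ D m) (hA.inter (hD m))
      (inter_subset_right.trans (hDball m)) (inter_subset_left.trans hAM),
      ← measure_iUnion (fun i j hij => ((disjoint_disjointed _) hij).mono
        inter_subset_right inter_subset_right) fun m => hA.inter (hD m),
      ← inter_iUnion, hDU, inter_univ]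
  refine ⟨⟨ζ, fun A hA hb => ?_, fun A hA => ?_⟩, fun m r hr => Measure.ext fun A hA => ?_⟩
  · obtain ⟨R, hR⟩ := hb.subset_ball x₀
    obtain ⟨M, hM⟩ := exists_nat_ge R
    rw [hloc M A hA (hR.trans (Metric.ball_subset_ball hM))]
    exact measure_lt_top _ _
  · rw [hζ A hA]
    exact tsum_eq_top_or_natCast fun m => hη m _ (hA.inter (hD m))
  · rw [restrictBall_apply x₀ _ r hA, Measure.restrict_apply hA]
    exact hloc m _ (hA.inter Metric.isOpen_ball.measurableSet)
      (inter_subset_right.trans (Metric.ball_subset_ball hr))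

variable [CompleteSpace X] [SeparableSpace X]

/-- If the restrictions to one ball form a fast Cauchy sequence, then the restrictions to all
smaller balls converge, finitely many radii excepted. -/
lemma exists_tendsto_restrictBall {u : ℕ → BoundedlyFiniteIntMeasure X} {R : ℝ}
    (h : Summable fun n => prohorovDist (restrictBall x₀ (u n) R) (restrictBall x₀ (u (n + 1)) R)) :
    ∃ (k : ℕ) (f : Fin k → X), ∀ r ≤ R, (∀ i, dist (f i) x₀ ≠ r) →
      Tendsto (fun n => prohorovDist (restrictBall x₀ (u n) r)
        ((diracSum f).restrict (Metric.ball x₀ r))) atTop (𝓝 0) := by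
  obtain ⟨k, N, f, y, hy, hlim⟩ := exists_tendsto_diracSum
    (fun n _ hA => exists_natCast_eq_restrictBall x₀ (u n) R hA) h
  refine ⟨k, f, fun r hr hne => (tendsto_add_atTop_iff_nat N).1 ?_⟩
  simp_rw [← restrictBall_restrict_ball x₀ (u _) hr, hy]
  exact tendsto_prohorovDist_restrict_ball hlim x₀ hne

lemma exists_tendsto_weakHashDist {u : ℕ → BoundedlyFiniteIntMeasure X}
    (h : Summable fun n => weakHashDist x₀ (u n) (u (n + 1))) :
    ∃ ξ, Tendsto (fun n => weakHashDist x₀ (u n) ξ) atTop (𝓝 0) := by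
  have hfreq := frequently_atTop_of_ae (ae_summable_prohorovDist x₀ h)
  have hlim : ∀ m : ℕ, ∃ (k : ℕ) (f : Fin k → X), ∀ r ≤ (m : ℝ), (∀ i, dist (f i) x₀ ≠ r) →
      Tendsto (fun n => prohorovDist (restrictBall x₀ (u n) r)
        ((diracSum f).restrict (Metric.ball x₀ r))) atTop (𝓝 0) := fun m => by
    obtain ⟨R, hR, hmR⟩ := (hfreq.and_eventually (eventually_ge_atTop (m : ℝ))).exists
    obtain ⟨k, f, hf⟩ := exists_tendsto_restrictBall x₀ hR
    exact ⟨k, f, fun r hr => hf r (hr.trans hmR)⟩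
  choose k f hf using hlim
  -- the limits obtained for two balls agree on the smaller one, since they agree on the
  -- concentric balls of almost all smaller radii
  have hle : ∀ (m M : ℕ) (A : Set X), MeasurableSet A → A ⊆ Metric.ball x₀ (m : ℝ) →
      A ⊆ Metric.ball x₀ (M : ℝ) → diracSum (f m) A ≤ diracSum (f M) A := by
    intro m M A hA hAm hAM
    have hA' : A = A ∩ Metric.ball x₀ (min m M : ℝ) := by
      refine (inter_eq_left.2 fun x hx => ?_).symm
      exact Metric.mem_ball.2 (lt_min (Metric.mem_ball.1 (hAm hx)) (Metric.mem_ball.1 (hAM hx)))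
    conv_lhs => rw [hA']
    rw [measure_inter_ball_eq_iSup]
    refine iSup₂_le fun q hq => ?_
    obtain ⟨r, ⟨hqr, hrm⟩, hr⟩ := (Ioo_infinite hq).exists_notMem_finite
      ((finite_range fun i => dist (f m i) x₀).union (finite_range fun i => dist (f M i) x₀))
    have h1 := hf m r (hrm.le.trans (min_le_left _ _)) fun i hi => hr (Or.inl ⟨i, hi⟩)
    have h2 := hf M r (hrm.le.trans (min_le_right _ _)) fun i hi => hr (Or.inr ⟨i, hi⟩)
    have heq : (diracSum (f m)).restrict (Metric.ball x₀ r) =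
        (diracSum (f M)).restrict (Metric.ball x₀ r) := by
      refine eq_of_prohorovDist_eq_zero (le_antisymm ?_ (prohorovDist_nonneg _ _))
      refine ge_of_tendsto' (by simpa using h1.add h2) fun n => ?_
      rw [prohorovDist_comm (restrictBall x₀ (u n) r) ((diracSum (f m)).restrict _)]
      exact prohorovDist_triangle _ _ _
    calc diracSum (f m) (A ∩ Metric.ball x₀ q)
        ≤ diracSum (f m) (A ∩ Metric.ball x₀ r) :=
          measure_mono (inter_subset_inter_right _ (Metric.ball_subset_ball hqr.le))
      _ = diracSum (f M) (A ∩ Metric.ball x₀ r) := by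
          rw [← Measure.restrict_apply hA, heq, Measure.restrict_apply hA]
      _ ≤ diracSum (f M) A := measure_mono inter_subset_left
  obtain ⟨ξ, hξ⟩ := exists_glue x₀ (η := fun m => diracSum (f m))
    (fun m A hA => exists_natCast_eq_diracSum (f m) hA)
    fun m M A hA h1 h2 => le_antisymm (hle m M A hA h1 h2) (hle M m A hA h2 h1)
  refine ⟨ξ, tendsto_weakHashDist_of_ae x₀ (ae_restrict_of_ae ?_)⟩
  have hae : ∀ᵐ r ∂(volume : Measure ℝ), r ∉ ⋃ m, range fun i => dist (f m i) x₀ :=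
    (countable_iUnion fun m => (finite_range _).countable).ae_notMem _
  filter_upwards [hae] with r hr
  obtain ⟨m, hm⟩ := exists_nat_ge r
  rw [hξ m r hm]
  exact hf m r hm fun i hi => hr (mem_iUnion.2 ⟨m, i, hi⟩)

lemma completeSpace_weakHash :
    letI := weakHashMetricSpace x₀
    CompleteSpace (BoundedlyFiniteIntMeasure X) := by
  let _ := weakHashMetricSpace x₀
  refine Metric.complete_of_convergent_controlled_sequences (fun n => (1 / 2) ^ n)
    (fun n => by positivity) fun u hu => ?_
  obtain ⟨ξ, hξ⟩ := exists_tendsto_weakHashDist x₀ (u := u) <|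
    Summable.of_nonneg_of_le (fun n => weakHashDist_nonneg x₀ _ _)
      (fun n => (hu n n (n + 1) le_rfl (Nat.le_succ n)).le) summable_geometric_two
  exact ⟨ξ, tendsto_iff_dist_tendsto_zero.2 hξ⟩

end Complete

/-! ### The Borel σ-algebra -/

section Borel

variable {X : Type*} [MetricSpace X] [MeasurableSpace X] [BorelSpace X] [SeparableSpace X] (x₀ : X)

/-- Evaluation at an open set is lower semicontinuous. -/
lemma isClosed_setOf_measure_le {U : Set X} (hU : IsOpen U) (c : ℝ≥0∞) :
    letI := weakHashMetricSpace x₀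
    IsClosed {ξ : BoundedlyFiniteIntMeasure X | ξ.toMeasure U ≤ c} := by
  let _ := weakHashMetricSpace x₀
  refine IsSeqClosed.isClosed fun u ξ hu hlim => ?_
  have hlim' : Tendsto (fun n => weakHashDist x₀ (u n) ξ) atTop (𝓝 0) :=
    tendsto_iff_dist_tendsto_zero.1 hlim
  obtain ⟨φ, -, hφ⟩ := extraction_forall_of_eventually
    (P := fun k n => weakHashDist x₀ (u n) ξ < (1 / 2 : ℝ) ^ k)
    fun k => hlim'.eventually_lt_const (by positivity)
  have hs := ae_summable_prohorovDist x₀ (u := u ∘ φ) (v := fun _ => ξ) <|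
    Summable.of_nonneg_of_le (fun n => weakHashDist_nonneg x₀ _ _) (fun n => (hφ n).le)
      summable_geometric_two
  refine measure_le_of_frequently_restrictBall_le x₀ hU.measurableSet <|
    (frequently_atTop_of_ae hs).mono fun r hr => ?_
  exact measure_le_of_tendsto_prohorovDist hr.tendsto_atTop_zero hU fun n =>
    (Measure.restrict_apply_le _ _).trans (hu (φ n))

/-- Open sets pass to all Borel sets by the π-λ theorem, applied to the finite restrictions to
balls. -/
lemma measurable_eval_borel {A : Set X} (hA : MeasurableSet A) :
    letI := weakHashMetricSpace x₀
    Measurable[borel (BoundedlyFiniteIntMeasure X)] fun ξ => ξ.toMeasure A := by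
  let _ := weakHashMetricSpace x₀
  let _ : MeasurableSpace (BoundedlyFiniteIntMeasure X) := borel _
  have : BorelSpace (BoundedlyFiniteIntMeasure X) := ⟨rfl⟩
  have hopen : ∀ U : Set X, IsOpen U →
      Measurable fun ξ : BoundedlyFiniteIntMeasure X => ξ.toMeasure U := fun U hU =>
    measurable_of_Iic fun c => (isClosed_setOf_measure_le x₀ hU c).measurableSet
  have hball : ∀ n : ℕ, Measurable fun ξ : BoundedlyFiniteIntMeasure X =>
      restrictBall x₀ ξ n := fun n => by
    refine Measurable.measure_of_isPiSystem (S := {U | IsOpen U}) BorelSpace.measurable_eq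
      isPiSystem_isOpen (fun U hU => ?_) ?_
    · simp_rw [restrictBall_apply x₀ _ _ (IsOpen.measurableSet hU)]
      exact hopen _ (IsOpen.inter hU Metric.isOpen_ball)
    · simp_rw [restrictBall_apply x₀ _ _ MeasurableSet.univ]
      exact hopen _ (isOpen_univ.inter Metric.isOpen_ball)
  have hsup : (fun ξ : BoundedlyFiniteIntMeasure X => ξ.toMeasure A) =
      fun ξ => ⨆ n : ℕ, restrictBall x₀ ξ n A := by
    ext ξ
    refine le_antisymm (measure_le_of_frequently_restrictBall_le x₀ hA
      (frequently_atTop.2 fun a => ?_)) (iSup_le fun n => Measure.restrict_apply_le _ _)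
    obtain ⟨n, hn⟩ := exists_nat_ge a
    exact ⟨n, hn, le_iSup (fun n : ℕ => restrictBall x₀ ξ n A) n⟩
  rw [hsup]
  exact Measurable.iSup fun n => (Measure.measurable_coe hA).comp (hball n)

/-- Open sets are countable unions of balls, and balls are measurable because the distance to a
fixed measure is. -/
lemma borel_weakHash_le {m : MeasurableSpace (BoundedlyFiniteIntMeasure X)}
    (hm : ∀ A : Set X, MeasurableSet A →
      Measurable fun ξ : BoundedlyFiniteIntMeasure X => ξ.toMeasure A) :
    letI := weakHashMetricSpace x₀
    borel (BoundedlyFiniteIntMeasure X) ≤ m := by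
  let _ := weakHashMetricSpace x₀
  have := separableSpace_weakHash x₀
  have : SecondCountableTopology (BoundedlyFiniteIntMeasure X) :=
    UniformSpace.secondCountable_of_separable _
  have hball : ∀ (ν : BoundedlyFiniteIntMeasure X) (ε : ℝ), MeasurableSet (Metric.ball ν ε) := by
    intro ν ε
    have h : Measurable fun ξ : BoundedlyFiniteIntMeasure X => weakHashDist x₀ ξ ν :=
      ((measurable_weakHashIntegrand x₀ (ζ := id) hm ν).stronglyMeasurable.integral_prod_right
        (ν := volume.restrict (Ioi (0 : ℝ)))).measurable
    exact h measurableSet_Iio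
  refine MeasurableSpace.generateFrom_le fun U (hU : IsOpen U) => ?_
  choose! ε hε hεU using Metric.isOpen_iff.1 hU
  obtain ⟨T, hT, hTU⟩ := isOpen_iUnion_countable
    (fun ν : U => Metric.ball (ν : BoundedlyFiniteIntMeasure X) (ε ν)) fun _ => Metric.isOpen_ball
  have : U = ⋃ ν ∈ T, Metric.ball (ν : BoundedlyFiniteIntMeasure X) (ε ν) := by
    rw [hTU]
    exact subset_antisymm
      (fun ν (hν : ν ∈ U) => mem_iUnion.2 ⟨(⟨ν, hν⟩ : U), Metric.mem_ball_self (hε ν hν)⟩)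
      (iUnion_subset fun ν => hεU ν ν.2)
  rw [this]
  exact MeasurableSet.biUnion hT fun ν _ => hball ν _

end Borel

end BoundedlyFiniteIntMeasure

theorem theorem1p2 {X : Type*} [MetricSpace X] [CompleteSpace X] [SeparableSpace X]
    [MeasurableSpace X] [BorelSpace X] (x₀ : X) :
    -- the integral defining the weak-hash distance is well defined
    (∀ μ ν : BoundedlyFiniteIntMeasure X,
      IntegrableOn (BoundedlyFiniteIntMeasure.weakHashIntegrand x₀ μ ν) (Ioi (0 : ℝ))) ∧
    -- the weak-hash distance is a metric
    ∃ inst : MetricSpace (BoundedlyFiniteIntMeasure X),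
      (∀ μ ν : BoundedlyFiniteIntMeasure X,
        dist μ ν = BoundedlyFiniteIntMeasure.weakHashDist x₀ μ ν) ∧
      -- complete and separable
      CompleteSpace (BoundedlyFiniteIntMeasure X) ∧
      SeparableSpace (BoundedlyFiniteIntMeasure X) ∧
      -- its Borel σ-algebra is the least one for which all evaluations are measurable
      IsLeast {m : MeasurableSpace (BoundedlyFiniteIntMeasure X) |
          ∀ A : Set X, MeasurableSet A →
            @Measurable _ ℝ≥0∞ m _ (fun ξ : BoundedlyFiniteIntMeasure X => ξ.toMeasure A)}
        (borel (BoundedlyFiniteIntMeasure X)) := by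
  refine ⟨BoundedlyFiniteIntMeasure.integrableOn_weakHashIntegrand x₀,
    BoundedlyFiniteIntMeasure.weakHashMetricSpace x₀, fun _ _ => rfl,
    BoundedlyFiniteIntMeasure.completeSpace_weakHash x₀,
    BoundedlyFiniteIntMeasure.separableSpace_weakHash x₀,
    fun A hA => BoundedlyFiniteIntMeasure.measurable_eval_borel x₀ hA,
    fun m hm => BoundedlyFiniteIntMeasure.borel_weakHash_le x₀ hm⟩
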